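/- Let $k\ge 1$, and let $J^k(\mathbb R)=\mathbb R^{k+2}$, with points written $(x,u_k,\dots,u_0)$, carry the group law \[ (x,u_k,\dots,u_0)\odot(y,v_k,\dots,v_0)=(x+y,w_k,\dots,w_0),\qquad w_s=u_s+v_s+\sum_{j=s+1}^k u_j\frac{y^{j-s}}{(j-s)!}\quad(0\le s\le k), \] and the Carnot–Carathéodory distance $d_{cc}$: $d_{cc}(p,q)$ is the infimum of the lengths of the horizontal curves connecting $p$ to $q$. Here a curve in $J^k(\mathbb R)$ is horizontal if it is absolutely continuous as a map into $\mathbb R^{k+2}$ and satisfies $u_j'=u_{j+1}x'$ almost everywhere for $j=0,\dots,k-1$, and its length is $\int\sqrt{(x')^2+(u_k')^2}$. Let $\dim_H$ denote the Hausdorff dimension with respect to $d_{cc}$. For $f\in C^\infty(\mathbb R)$ and $y\in\mathbb R$ put $j^k_y(f)=(y,f^{(k)}(y),\dots,f'(y),f(y))$, and for $t\in\mathbb R$ and $p=(x,u_k,\dots,u_0)$ define the vertical and horizontal mappings \[ V_{f,t}(p)=p\odot j^k_{x-t}(f)^{-1},\qquad J_{f,t}(p)=j^k_{x-t}(f). \]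 Then for all $t\in\mathbb R$, all $f\in C^\infty(\mathbb R)$ and all Borel sets $E\subset J^k(\mathbb R)$, \[ \dim_H V_{f,t}(E)\le\min\Big\{(k+1)\dim_H E,\ \frac{(k+1)(k+2)}2\Big\} \qquad\text{and}\qquad \dim_H J_{f,t}(E)\le\min\{\dim_H E,\ 1\}. \] -/

import Mathlib

open MeasureTheory Set Filter Topology
open scoped ENNReal ContDiff Nat

/-- The jet space `J^k(ℝ)`, identified with `ℝ^(k+2)`: a point `(x, u_k, …, u_0)` consists of the
base point `x` and of the numbers `u j = u_j` for `j = 0, …, k`. -/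
@[ext]
structure JetSpace (k : ℕ) where
  /-- the base point -/
  x : ℝ
  /-- the coordinate of index `j` is `u_j` -/
  u : Fin (k + 1) → ℝ

noncomputable section

namespace JetSpace

variable {k : ℕ}

/-! ### The group structure -/

/-- The group operation: `(x, u) ⊙ (y, v) = (x + y, w)` with
`w_s = u_s + v_s + ∑_{s < j ≤ k} u_j y^(j-s) / (j-s)!`. -/
instance : Mul (JetSpace k) where
  mul p q :=
    { x := p.x + q.x
      u := fun s => p.u s + q.u s +
        ∑ j ∈ Finset.Ioi s, p.u j * (q.x ^ ((j : ℕ) - (s : ℕ)) / (((j : ℕ) - (s : ℕ))! : ℝ)) }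

/-- The neutral element is the origin of `ℝ^(k+2)`. -/
instance : One (JetSpace k) where
  one := { x := 0, u := 0 }

/-- The inverse: `((x, u)⁻¹)_s = - ∑_{s ≤ j ≤ k} u_j (-x)^(j-s) / (j-s)!`. -/
instance : Inv (JetSpace k) where
  inv p :=
    { x := -p.x
      u := fun s => -∑ j ∈ Finset.Ici s,
        p.u j * ((-p.x) ^ ((j : ℕ) - (s : ℕ)) / (((j : ℕ) - (s : ℕ))! : ℝ)) }

/-- Translation of the base point of a Taylor polynomial. -/
def shift (y : ℝ) (u : Fin (k + 1) → ℝ) (s : Fin (k + 1)) : ℝ :=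
  ∑ j ∈ Finset.Ici s, u j * (y ^ ((j : ℕ) - (s : ℕ)) / (((j : ℕ) - (s : ℕ))! : ℝ))

@[simp] lemma mul_x (p q : JetSpace k) : (p * q).x = p.x + q.x := rfl

@[simp] lemma one_x : (1 : JetSpace k).x = 0 := rfl

@[simp] lemma one_u : (1 : JetSpace k).u = 0 := rfl

@[simp] lemma inv_x (p : JetSpace k) : (p⁻¹).x = -p.x := rfl

lemma inv_u (p : JetSpace k) (s : Fin (k + 1)) : (p⁻¹).u s = -shift (-p.x) p.u s := rfl

lemma mul_u (p q : JetSpace k) (s : Fin (k + 1)) :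
    (p * q).u s = q.u s + shift q.x p.u s := by
  have h : Finset.Ici s = insert s (Finset.Ioi s) := by
    ext j; simp [le_iff_eq_or_lt]
  change p.u s + q.u s + _ = _
  rw [shift, h, Finset.sum_insert (by simp)]
  simp only [Nat.sub_self, pow_zero, Nat.factorial_zero, Nat.cast_one, div_one, mul_one]
  ring

lemma shift_zero (u : Fin (k + 1) → ℝ) (s : Fin (k + 1)) : shift 0 u s = u s := by
  rw [shift, Finset.sum_eq_single s]
  · simp
  · intro j hj hne
    have h1 : s < j := lt_of_le_of_ne (Finset.mem_Ici.1 hj) (Ne.symm hne)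
    have : (j : ℕ) - (s : ℕ) ≠ 0 := by have : (s : ℕ) < j := h1; omega
    simp [this]
  · simp

lemma shift_add (y : ℝ) (u v : Fin (k + 1) → ℝ) (s : Fin (k + 1)) :
    shift y (fun j => u j + v j) s = shift y u s + shift y v s := by
  simp [shift, add_mul, Finset.sum_add_distrib]

lemma shift_neg (y : ℝ) (u : Fin (k + 1) → ℝ) (s : Fin (k + 1)) :
    shift y (fun j => -u j) s = -shift y u s := by
  simp [shift]

lemma sum_pow_div_factorial (y z : ℝ) (n : ℕ) :
    ∑ m ∈ Finset.range (n + 1), y ^ (n - m) / ((n - m)! : ℝ) * (z ^ m / (m ! : ℝ)) =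
      (z + y) ^ n / (n ! : ℝ) := by
  rw [add_pow, Finset.sum_div]
  refine Finset.sum_congr rfl fun m hm => ?_
  have hm' : m ≤ n := by simpa [Nat.lt_succ_iff] using hm
  rw [Nat.cast_choose ℝ hm']
  have h1 : (n ! : ℝ) ≠ 0 := by exact_mod_cast n.factorial_ne_zero
  have h2 : (m ! : ℝ) ≠ 0 := by exact_mod_cast m.factorial_ne_zero
  have h3 : ((n - m)! : ℝ) ≠ 0 := by exact_mod_cast (n - m).factorial_ne_zero
  field_simp

lemma shift_shift (y z : ℝ) (u : Fin (k + 1) → ℝ) (s : Fin (k + 1)) :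
    shift z (shift y u) s = shift (y + z) u s := by
  simp only [shift, Finset.sum_mul]
  rw [Finset.sum_comm' (s' := fun i => Finset.Icc s i) (t' := Finset.Ici s)]
  · refine Finset.sum_congr rfl fun i hi => ?_
    have hsi : s ≤ i := Finset.mem_Ici.1 hi
    rw [add_comm y z, ← sum_pow_div_factorial y z, Finset.mul_sum]
    refine Finset.sum_bij' (fun (j : Fin (k + 1)) _ => (j : ℕ) - s)
      (fun m hm => ⟨m + s, by
        have := Finset.mem_range.1 hm
        have := i.2
        omega⟩) ?_ ?_ ?_ ?_ ?_
    · intro j hj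
      have h := Finset.mem_Icc.1 hj
      have h1 : (s : ℕ) ≤ j := h.1
      have h2 : (j : ℕ) ≤ i := h.2
      simp only [Finset.mem_range]; omega
    · intro m hm
      have := Finset.mem_range.1 hm
      simp only [Finset.mem_Icc, Fin.le_def]; omega
    · intro j hj
      have h1 : (s : ℕ) ≤ j := (Finset.mem_Icc.1 hj).1
      ext; simp only; omega
    · intro m hm
      simp
    · intro j hj
      have h := Finset.mem_Icc.1 hj
      have h1 : (s : ℕ) ≤ j := h.1
      have h2 : (j : ℕ) ≤ i := h.2
      have h3 : (i : ℕ) - s - (j - s) = i - j := by omega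
      rw [h3]; ring
  · intro j i
    simp only [Finset.mem_Ici, Finset.mem_Icc]
    exact ⟨fun h => ⟨⟨h.1, h.2⟩, h.1.trans h.2⟩, fun h => ⟨h.1.1, h.1.2⟩⟩

/-- The jet space group. -/
instance : Group (JetSpace k) :=
  Group.ofLeftAxioms
    (by
      intro p q r
      ext s
      · simp [add_assoc]
      · have h : (p * q).u = fun j => q.u j + shift q.x p.u j := funext (mul_u p q)
        rw [mul_u, mul_u, mul_u, h, shift_add, shift_shift, mul_x, add_assoc])
    (by
      intro p
      ext s
      · simp
      · simp [mul_u, shift])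
    (by
      intro p
      ext s
      · simp
      · have h : (p⁻¹).u = fun j => -shift (-p.x) p.u j := funext (inv_u p)
        rw [mul_u, h, shift_neg, shift_shift, neg_add_cancel, shift_zero]
        simp)

/-! ### Horizontal curves and the Carnot-Carathéodory distance -/

/-- A curve `γ : [a, b] → J^k(ℝ)` is horizontal if it is absolutely continuous as a map into
`ℝ^(k+2)` (that is, in every coordinate) and its velocity is, almost everywhere, annihilated by the
contact forms `du_j - u_{j+1} dx`, `j = 0, …, k - 1`. Values of `γ` outside `[a, b]` play no
role. -/
structure IsHorizontal (γ : ℝ → JetSpace k) (a b : ℝ) : Prop where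
  le : a ≤ b
  ac_x : AbsolutelyContinuousOnInterval (fun s => (γ s).x) a b
  ac_u : ∀ j, AbsolutelyContinuousOnInterval (fun s => (γ s).u j) a b
  contact : ∀ᵐ s ∂volume.restrict (Icc a b), ∀ j : Fin k,
    deriv (fun r => (γ r).u j.castSucc) s = (γ s).u j.succ * deriv (fun r => (γ r).x) s

/-- The norm of the velocity of a horizontal curve, for the left-invariant metric on the horizontal
bundle in which the frame `X = ∂_x + u_k ∂_{u_{k-1}} + ⋯ + u_1 ∂_{u_0}`, `∂_{u_k}` is orthonormal:
a horizontal velocity is `x' X + u_k' ∂_{u_k}`. -/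
def speed (γ : ℝ → JetSpace k) (s : ℝ) : ℝ :=
  √(deriv (fun r => (γ r).x) s ^ 2 + deriv (fun r => (γ r).u (Fin.last k)) s ^ 2)

/-- The length of a horizontal curve on `[a, b]`. -/
def length (γ : ℝ → JetSpace k) (a b : ℝ) : ℝ≥0∞ :=
  ∫⁻ s in Icc a b, ENNReal.ofReal (speed γ s)

/-- The Carnot-Carathéodory distance: the infimum of the lengths of the horizontal curves that
connect `p` to `q`. -/
def ccEDist (p q : JetSpace k) : ℝ≥0∞ :=
  sInf {L | ∃ (γ : ℝ → JetSpace k) (a b : ℝ),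
    IsHorizontal γ a b ∧ γ a = p ∧ γ b = q ∧ length γ a b = L}

/-! ### The Carnot-Carathéodory distance is a metric -/

lemma ac_comp {f ψ : ℝ → ℝ} {a b c d : ℝ} (hf : AbsolutelyContinuousOnInterval f c d)
    (hψ : ∀ s t, dist (ψ s) (ψ t) ≤ dist s t) (hm : Monotone ψ ∨ Antitone ψ)
    (hmap : ∀ s ∈ uIcc a b, ψ s ∈ uIcc c d) :
    AbsolutelyContinuousOnInterval (fun s => f (ψ s)) a b := by
  rw [absolutelyContinuousOnInterval_iff] at hf ⊢
  intro ε hε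
  obtain ⟨δ, hδ, H⟩ := hf ε hε
  refine ⟨δ, hδ, fun E hE hlen => ?_⟩
  refine H (E.1, fun i => (ψ (E.2 i).1, ψ (E.2 i).2)) ⟨?_, ?_⟩ ?_
  · intro i hi
    exact ⟨hmap _ (hE.1 i hi).1, hmap _ (hE.1 i hi).2⟩
  · intro i hi j hj hij
    have h := hE.2 hi hj hij
    simp only [Function.onFun, uIoc, Ioc_disjoint_Ioc] at h ⊢
    rcases hm with hm | hm
    · simpa only [hm.map_min, hm.map_max] using hm h
    · simpa only [hm.map_min, hm.map_max] using hm h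
  · exact lt_of_le_of_lt (Finset.sum_le_sum fun i _ => hψ _ _) hlen

lemma length_const (p : JetSpace k) : length (fun _ => p) 0 0 = 0 := by
  simp [length]

lemma isHorizontal_const (p : JetSpace k) : IsHorizontal (fun _ => p) 0 0 where
  le := le_rfl
  ac_x := by
    rw [absolutelyContinuousOnInterval_iff]
    intro ε hε
    exact ⟨1, one_pos, fun E _ _ => by simpa using hε⟩
  ac_u j := by
    rw [absolutelyContinuousOnInterval_iff]
    intro ε hε
    exact ⟨1, one_pos, fun E _ _ => by simpa using hε⟩
  contact := by simp

lemma ccEDist_self (p : JetSpace k) : ccEDist p p = 0 :=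
  le_antisymm (sInf_le ⟨fun _ => p, 0, 0, isHorizontal_const p, rfl, rfl, length_const p⟩) bot_le

/-! Reversal of curves -/

lemma deriv_reverse (f : ℝ → ℝ) (s : ℝ) : deriv (fun r => f (-r)) s = -deriv f (-s) :=
  deriv_comp_neg f s

lemma speed_reverse (γ : ℝ → JetSpace k) (s : ℝ) :
    speed (fun r => γ (-r)) s = speed γ (-s) := by
  have h1 := deriv_reverse (fun r => (γ r).x) s
  have h2 := deriv_reverse (fun r => (γ r).u (Fin.last k)) s
  simp [speed, h1, h2]

lemma preimage_neg_Icc' (a b : ℝ) : (fun s : ℝ => -s) ⁻¹' Icc a b = Icc (-b) (-a) := by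
  ext s; simp only [mem_preimage, mem_Icc]
  constructor <;> rintro ⟨h1, h2⟩ <;> constructor <;> linarith

lemma length_reverse (γ : ℝ → JetSpace k) (a b : ℝ) :
    length (fun r => γ (-r)) (-b) (-a) = length γ a b := by
  have h := (Measure.measurePreserving_neg (volume : Measure ℝ)).setLIntegral_comp_preimage_emb
    (MeasurableEquiv.neg ℝ).measurableEmbedding
    (fun s => ENNReal.ofReal (speed γ s)) (Icc a b)
  rw [length, length, ← h]
  simp only [speed_reverse]
  congr 2
  exact (preimage_neg_Icc' a b).symm

lemma IsHorizontal.reverse {γ : ℝ → JetSpace k} {a b : ℝ} (h : IsHorizontal γ a b) :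
    IsHorizontal (fun r => γ (-r)) (-b) (-a) := by
  have hmap : ∀ s ∈ uIcc (-b) (-a), -s ∈ uIcc a b := by
    intro s hs
    rw [uIcc_of_le (neg_le_neg h.le), mem_Icc] at hs
    rw [uIcc_of_le h.le, mem_Icc]
    constructor <;> linarith
  have hd : ∀ s t : ℝ, dist (-s) (-t) ≤ dist s t := fun s t => (dist_neg_neg s t).le
  have hn : Monotone (fun s : ℝ => -s) ∨ Antitone (fun s : ℝ => -s) :=
    Or.inr fun _ _ => neg_le_neg
  refine ⟨neg_le_neg h.le, ac_comp (f := fun s => (γ s).x) (ψ := fun s => -s) h.ac_x hd hn hmap,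
    fun j => ac_comp (f := fun s => (γ s).u j) (ψ := fun s => -s) (h.ac_u j) hd hn hmap, ?_⟩
  have h1 := h.contact
  rw [ae_restrict_iff' measurableSet_Icc] at h1 ⊢
  have h2 := (Measure.measurePreserving_neg (volume : Measure ℝ)).quasiMeasurePreserving.ae h1
  filter_upwards [h2] with s hs hsm j
  have h3 := hs ⟨by linarith [hsm.2], by linarith [hsm.1]⟩ j
  have e1 := deriv_reverse (fun r => (γ r).x) s
  have e2 := deriv_reverse (fun r => (γ r).u j.castSucc) s
  rw [e1, e2, h3]
  ring

lemma ccEDist_le_comm (p q : JetSpace k) : ccEDist p q ≤ ccEDist q p := by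
  refine le_sInf ?_
  rintro L ⟨γ, a, b, h, ha, hb, rfl⟩
  exact sInf_le ⟨fun r => γ (-r), -b, -a, h.reverse, by simpa using hb, by simpa using ha,
    length_reverse γ a b⟩

lemma ccEDist_comm (p q : JetSpace k) : ccEDist p q = ccEDist q p :=
  le_antisymm (ccEDist_le_comm p q) (ccEDist_le_comm q p)

/-! Concatenation of curves -/

/-- The curve that runs through `γ₁` up to time `b` and then through `γ₂` from time `c` on. -/
def concat (γ₁ γ₂ : ℝ → JetSpace k) (b c : ℝ) (s : ℝ) : JetSpace k :=
  if s ≤ b then γ₁ s else γ₂ (s + (c - b))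

lemma concat_eventuallyEq_left {γ₁ γ₂ : ℝ → JetSpace k} {b c s : ℝ} (hs : s < b) :
    concat γ₁ γ₂ b c =ᶠ[𝓝 s] γ₁ := by
  filter_upwards [Iio_mem_nhds hs] with r hr
  simp [concat, le_of_lt (mem_Iio.1 hr)]

lemma concat_eventuallyEq_right {γ₁ γ₂ : ℝ → JetSpace k} {b c s : ℝ} (hs : b < s) :
    concat γ₁ γ₂ b c =ᶠ[𝓝 s] fun r => γ₂ (r + (c - b)) := by
  filter_upwards [Ioi_mem_nhds hs] with r hr
  simp [concat, not_le.2 (mem_Ioi.1 hr)]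

lemma deriv_concat_left {γ₁ γ₂ : ℝ → JetSpace k} {b c s : ℝ} (hs : s < b) (F : JetSpace k → ℝ) :
    deriv (fun r => F (concat γ₁ γ₂ b c r)) s = deriv (fun r => F (γ₁ r)) s :=
  ((concat_eventuallyEq_left hs).fun_comp F).deriv_eq

lemma deriv_concat_right {γ₁ γ₂ : ℝ → JetSpace k} {b c s : ℝ} (hs : b < s)
    (F : JetSpace k → ℝ) :
    deriv (fun r => F (concat γ₁ γ₂ b c r)) s = deriv (fun r => F (γ₂ r)) (s + (c - b)) := by
  rw [← deriv_comp_add_const]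
  exact ((concat_eventuallyEq_right hs).fun_comp F).deriv_eq

lemma ac_concat {γ₁ γ₂ : ℝ → JetSpace k} {a b c d : ℝ} (F : JetSpace k → ℝ) (hab : a ≤ b)
    (hcd : c ≤ d) (h : γ₁ b = γ₂ c)
    (h1 : AbsolutelyContinuousOnInterval (fun s => F (γ₁ s)) a b)
    (h2 : AbsolutelyContinuousOnInterval (fun s => F (γ₂ s)) c d) :
    AbsolutelyContinuousOnInterval (fun s => F (concat γ₁ γ₂ b c s)) a (b + (d - c)) := by
  have e : (fun s => F (concat γ₁ γ₂ b c s)) =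
      fun s => F (γ₁ (min s b)) + (F (γ₂ (max (s + (c - b)) c)) - F (γ₁ b)) := by
    funext s
    rcases le_or_gt s b with hs | hs
    · rw [min_eq_left hs, max_eq_right (by linarith), ← h]
      simp [concat, hs]
    · rw [min_eq_right hs.le, max_eq_left (by linarith)]
      simp [concat, not_le.2 hs]
  have hle : a ≤ b + (d - c) := by linarith
  have g1 : AbsolutelyContinuousOnInterval (fun s => F (γ₁ (min s b))) a (b + (d - c)) := by
    refine ac_comp (f := fun s => F (γ₁ s)) (ψ := fun s => min s b) h1 (fun s t => ?_) (Or.inl fun s t hst => min_le_min_right b hst) ?_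
    · simpa [Real.dist_eq] using abs_min_sub_min_le_max s b t b
    · intro s hs
      rw [uIcc_of_le hle, mem_Icc] at hs
      rw [uIcc_of_le hab, mem_Icc]
      exact ⟨le_min hs.1 hab, min_le_right _ _⟩
  have g2 : AbsolutelyContinuousOnInterval (fun s => F (γ₂ (max (s + (c - b)) c))) a
      (b + (d - c)) := by
    refine ac_comp (f := fun s => F (γ₂ s)) (ψ := fun s => max (s + (c - b)) c) h2 (fun s t => ?_)
      (Or.inl fun s t hst => max_le_max_right c (by linarith)) ?_
    · simpa [Real.dist_eq] using abs_max_sub_max_le_max (s + (c - b)) c (t + (c - b)) c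
    · intro s hs
      rw [uIcc_of_le hle, mem_Icc] at hs
      rw [uIcc_of_le hcd, mem_Icc]
      exact ⟨le_max_right _ _, max_le (by linarith) hcd⟩
  have g3 : AbsolutelyContinuousOnInterval (fun _ : ℝ => F (γ₁ b)) a (b + (d - c)) := by
    rw [absolutelyContinuousOnInterval_iff]
    intro ε hε
    exact ⟨1, one_pos, fun E _ _ => by simpa using hε⟩
  rw [e]
  exact g1.add (g2.sub g3)

lemma preimage_add_Icc (b c d : ℝ) :
    (fun s : ℝ => s + (c - b)) ⁻¹' Icc c d = Icc b (b + (d - c)) := by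
  ext s; simp only [mem_preimage, mem_Icc]
  constructor <;> rintro ⟨h1, h2⟩ <;> constructor <;> linarith

lemma IsHorizontal.concat {γ₁ γ₂ : ℝ → JetSpace k} {a b c d : ℝ} (h₁ : IsHorizontal γ₁ a b)
    (h₂ : IsHorizontal γ₂ c d) (h : γ₁ b = γ₂ c) :
    IsHorizontal (concat γ₁ γ₂ b c) a (b + (d - c)) := by
  refine ⟨by linarith [h₁.le, h₂.le], ac_concat (fun p => p.x) h₁.le h₂.le h h₁.ac_x h₂.ac_x,
    fun j => ac_concat (fun p => p.u j) h₁.le h₂.le h (h₁.ac_u j) (h₂.ac_u j), ?_⟩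
  have k1 := h₁.contact
  have k2 := h₂.contact
  rw [ae_restrict_iff' measurableSet_Icc] at k1 k2 ⊢
  have k3 := (measurePreserving_add_right (volume : Measure ℝ) (c - b)).quasiMeasurePreserving.ae k2
  have k4 : ∀ᵐ s : ℝ, s ≠ b := by simp [ae_iff]
  filter_upwards [k1, k3, k4] with s hs1 hs2 hsb hsm j
  rcases lt_or_gt_of_ne hsb with hs | hs
  · have e1 := deriv_concat_left (γ₁ := γ₁) (γ₂ := γ₂) (c := c) hs (fun p => p.x)
    have e2 := deriv_concat_left (γ₁ := γ₁) (γ₂ := γ₂) (c := c) hs (fun p => p.u j.castSucc)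
    rw [e1, e2, hs1 ⟨hsm.1, hs.le⟩ j]
    simp [JetSpace.concat, hs.le]
  · have e1 := deriv_concat_right (γ₁ := γ₁) (γ₂ := γ₂) (c := c) hs (fun p => p.x)
    have e2 := deriv_concat_right (γ₁ := γ₁) (γ₂ := γ₂) (c := c) hs (fun p => p.u j.castSucc)
    rw [e1, e2, hs2 ⟨by linarith, by linarith [hsm.2]⟩ j]
    simp [JetSpace.concat, not_le.2 hs]

lemma length_concat_le (γ₁ γ₂ : ℝ → JetSpace k) {a b c d : ℝ} (hab : a ≤ b) (hcd : c ≤ d) :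
    length (concat γ₁ γ₂ b c) a (b + (d - c)) ≤ length γ₁ a b + length γ₂ c d := by
  have hu : Icc a (b + (d - c)) = Icc a b ∪ Icc b (b + (d - c)) :=
    (Icc_union_Icc_eq_Icc hab (by linarith)).symm
  have hne : ∀ᵐ s : ℝ, s ≠ b := by simp [ae_iff]
  have l1 : length (concat γ₁ γ₂ b c) a b = length γ₁ a b := by
    refine setLIntegral_congr_fun_ae measurableSet_Icc ?_
    filter_upwards [hne] with s hsb hsm
    have hs : s < b := lt_of_le_of_ne hsm.2 hsb
    have e1 := deriv_concat_left (γ₁ := γ₁) (γ₂ := γ₂) (c := c) hs (fun p => p.x)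
    have e2 := deriv_concat_left (γ₁ := γ₁) (γ₂ := γ₂) (c := c) hs (fun p => p.u (Fin.last k))
    simp only [speed, e1, e2]
  have l2 : length (concat γ₁ γ₂ b c) b (b + (d - c)) = length γ₂ c d := by
    have h := (measurePreserving_add_right (volume : Measure ℝ)
      (c - b)).setLIntegral_comp_preimage_emb (measurableEmbedding_addRight (c - b))
      (fun s => ENNReal.ofReal (speed γ₂ s)) (Icc c d)
    rw [preimage_add_Icc] at h
    rw [length, length, ← h]
    refine setLIntegral_congr_fun_ae measurableSet_Icc ?_
    filter_upwards [hne] with s hsb hsm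
    have hs : b < s := lt_of_le_of_ne hsm.1 (Ne.symm hsb)
    have e1 := deriv_concat_right (γ₁ := γ₁) (γ₂ := γ₂) (c := c) hs (fun p => p.x)
    have e2 := deriv_concat_right (γ₁ := γ₁) (γ₂ := γ₂) (c := c) hs (fun p => p.u (Fin.last k))
    simp only [speed, e1, e2]
  rw [← l1, ← l2]
  simp only [length]
  rw [hu]
  exact lintegral_union_le _ _ _

lemma ccEDist_triangle (p q r : JetSpace k) : ccEDist p r ≤ ccEDist p q + ccEDist q r := by
  rw [ccEDist, ccEDist, ccEDist, ENNReal.sInf_add]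
  refine le_iInf₂ ?_
  rintro L₁ ⟨γ₁, a, b, h₁, rfl, hq, rfl⟩
  rw [ENNReal.add_sInf]
  refine le_iInf₂ ?_
  rintro L₂ ⟨γ₂, c, d, h₂, hq', rfl, rfl⟩
  have hb : γ₁ b = γ₂ c := hq.trans hq'.symm
  refine le_trans (sInf_le ?_) (length_concat_le γ₁ γ₂ h₁.le h₂.le)
  refine ⟨concat γ₁ γ₂ b c, a, b + (d - c), h₁.concat h₂ hb, ?_, ?_, rfl⟩
  · simp [concat, h₁.le]
  · rcases h₂.le.eq_or_lt with e | e
    · subst e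
      simp [concat, hb]
    · rw [concat, if_neg (by linarith)]
      congr 1
      ring

/-! Separation of points -/

lemma abs_sub_le_of_deriv_le {γ : ℝ → JetSpace k} {f : ℝ → ℝ} {a b L C : ℝ} (hab : a ≤ b)
    (hf : AbsolutelyContinuousOnInterval f a b) (hC : 0 ≤ C) (hL : 0 ≤ L)
    (hlen : length γ a b ≤ ENNReal.ofReal L)
    (hd : ∀ᵐ s ∂volume.restrict (Icc a b), |deriv f s| ≤ C * speed γ s) :
    ∀ s ∈ Icc a b, |f s - f a| ≤ C * L := by
  intro s hs
  have hsub : uIcc a s ⊆ uIcc a b := by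
    rw [uIcc_of_le hs.1, uIcc_of_le hab]; exact Icc_subset_Icc_right hs.2
  rw [← (hf.mono hsub).integral_deriv_eq_sub, intervalIntegral.integral_of_le hs.1]
  have h1 : ‖∫ t in Ioc a s, deriv f t‖ₑ ≤ ENNReal.ofReal (C * L) := by
    calc ‖∫ t in Ioc a s, deriv f t‖ₑ ≤ ∫⁻ t in Ioc a s, ‖deriv f t‖ₑ :=
          enorm_integral_le_lintegral_enorm _
      _ ≤ ∫⁻ t in Icc a b, ‖deriv f t‖ₑ :=
          lintegral_mono_set (Ioc_subset_Icc_self.trans (Icc_subset_Icc_right hs.2))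
      _ ≤ ∫⁻ t in Icc a b, ENNReal.ofReal C * ENNReal.ofReal (speed γ t) := by
          refine lintegral_mono_ae ?_
          filter_upwards [hd] with t ht
          rw [← ENNReal.ofReal_mul hC, ← ofReal_norm, Real.norm_eq_abs]
          exact ENNReal.ofReal_le_ofReal ht
      _ = ENNReal.ofReal C * length γ a b := lintegral_const_mul' _ _ ENNReal.ofReal_ne_top
      _ ≤ ENNReal.ofReal (C * L) := by
          rw [ENNReal.ofReal_mul hC]; gcongr
  rw [← ofReal_norm, Real.norm_eq_abs,
    ENNReal.ofReal_le_ofReal_iff (mul_nonneg hC hL)] at h1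
  exact h1

lemma abs_deriv_x_le_speed (γ : ℝ → JetSpace k) (s : ℝ) :
    |deriv (fun r => (γ r).x) s| ≤ speed γ s :=
  Real.abs_le_sqrt (by nlinarith [sq_nonneg (deriv (fun r => (γ r).u (Fin.last k)) s)])

lemma abs_deriv_u_le_speed (γ : ℝ → JetSpace k) (s : ℝ) :
    |deriv (fun r => (γ r).u (Fin.last k)) s| ≤ speed γ s :=
  Real.abs_le_sqrt (by nlinarith [sq_nonneg (deriv (fun r => (γ r).x) s)])

/-- On short horizontal curves that start at `p` the coordinates are controlled by the length. -/
lemma exists_coord_bound (p : JetSpace k) (j : Fin (k + 1)) :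
    ∃ C : ℝ, 0 ≤ C ∧ ∀ (γ : ℝ → JetSpace k) (a b L : ℝ), IsHorizontal γ a b → γ a = p →
      0 ≤ L → L ≤ 1 → length γ a b ≤ ENNReal.ofReal L →
      ∀ s ∈ Icc a b, |(γ s).u j - p.u j| ≤ C * L := by
  induction j using Fin.reverseInduction with
  | last =>
    refine ⟨1, zero_le_one, ?_⟩
    rintro γ a b L h rfl hL0 _ hL
    exact abs_sub_le_of_deriv_le h.le (h.ac_u _) zero_le_one hL0 hL
      (Eventually.of_forall fun s => by simpa using abs_deriv_u_le_speed γ s)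
  | cast j ih =>
    obtain ⟨C, hC, H⟩ := ih
    refine ⟨|p.u j.succ| + C, by positivity, ?_⟩
    rintro γ a b L h rfl hL0 hL1 hL
    refine abs_sub_le_of_deriv_le h.le (h.ac_u _) (by positivity) hL0 hL ?_
    filter_upwards [h.contact, ae_restrict_mem measurableSet_Icc] with s hs hsm
    rw [hs j, abs_mul]
    have b1 := H γ a b L h rfl hL0 hL1 hL s hsm
    have b2 : |(γ s).u j.succ| ≤ |(γ a).u j.succ| + C := by
      have := abs_sub_abs_le_abs_sub ((γ s).u j.succ) ((γ a).u j.succ)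
      nlinarith
    exact mul_le_mul b2 (abs_deriv_x_le_speed γ s) (abs_nonneg _) (by positivity)

lemma eq_of_ccEDist_eq_zero {p q : JetSpace k} (h : ccEDist p q = 0) : p = q := by
  have key : ∀ ε : ℝ, 0 < ε → ∃ (γ : ℝ → JetSpace k) (a b : ℝ),
      IsHorizontal γ a b ∧ γ a = p ∧ γ b = q ∧ length γ a b ≤ ENNReal.ofReal ε := by
    intro ε hε
    have h1 : ccEDist p q < ENNReal.ofReal ε := by rw [h]; exact ENNReal.ofReal_pos.2 hε
    obtain ⟨L, ⟨γ, a, b, h2, h3, h4, rfl⟩, h6⟩ := sInf_lt_iff.1 h1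
    exact ⟨γ, a, b, h2, h3, h4, h6.le⟩
  have aux : ∀ C t : ℝ, 0 ≤ C → (∀ ε : ℝ, 0 < ε → ε ≤ 1 → |t| ≤ C * ε) → t = 0 := by
    intro C t hC ht
    by_contra hne
    have hpos : 0 < |t| := abs_pos.2 hne
    have h1 := ht (min 1 (|t| / (2 * (C + 1)))) (by positivity) (min_le_left _ _)
    have h2 : C * min 1 (|t| / (2 * (C + 1))) ≤ C * (|t| / (2 * (C + 1))) :=
      mul_le_mul_of_nonneg_left (min_le_right _ _) hC
    have h3 : C * (|t| / (2 * (C + 1))) ≤ |t| / 2 := by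
      rw [mul_div_assoc', div_le_div_iff₀ (by positivity) (by positivity)]
      nlinarith
    linarith
  ext j
  · have := aux 1 (q.x - p.x) zero_le_one (fun ε hε _ => by
      obtain ⟨γ, a, b, h2, rfl, rfl, h5⟩ := key ε hε
      exact abs_sub_le_of_deriv_le h2.le h2.ac_x zero_le_one hε.le h5
        (Eventually.of_forall fun s => by simpa using abs_deriv_x_le_speed γ s) b ⟨h2.le, le_rfl⟩)
    linarith
  · obtain ⟨C, hC, H⟩ := exists_coord_bound p j
    have := aux C (q.u j - p.u j) hC (fun ε hε hε1 => by
      obtain ⟨γ, a, b, h2, h3, rfl, h5⟩ := key ε hε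
      exact H γ a b ε h2 h3 hε.le hε1 h5 b ⟨h2.le, le_rfl⟩)
    linarith

/-- The jet space with its Carnot-Carathéodory distance. -/
instance : EMetricSpace (JetSpace k) where
  edist := ccEDist
  edist_self := ccEDist_self
  edist_comm := ccEDist_comm
  edist_triangle := ccEDist_triangle
  eq_of_edist_eq_zero := eq_of_ccEDist_eq_zero

instance : MeasurableSpace (JetSpace k) := borel _

instance : BorelSpace (JetSpace k) := ⟨rfl⟩

/-! ### Jets, and the horizontal and vertical mappings -/

/-- The jet `j^k_y(f) = (y, f^(k)(y), …, f(y))`. -/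
def jet (k : ℕ) (f : ℝ → ℝ) (y : ℝ) : JetSpace k where
  x := y
  u := fun j => iteratedDeriv j f y

/-- The vertical mapping `V_{f,t}(p) = p ⊙ j^k_{x-t}(f)⁻¹`, where `x` is the base point of `p`. -/
def verticalMap (f : ℝ → ℝ) (t : ℝ) (p : JetSpace k) : JetSpace k :=
  p * (jet k f (p.x - t))⁻¹

/-- The horizontal mapping `J_{f,t}(p) = j^k_{x-t}(f)`, where `x` is the base point of `p`. -/
def horizontalMap (f : ℝ → ℝ) (t : ℝ) (p : JetSpace k) : JetSpace k :=
  jet k f (p.x - t)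

end JetSpace

end

noncomputable section

namespace JetSpace

variable {k : ℕ}

/-! ### Jets of smooth functions along an interval -/

/-! The jet of a smooth function is a horizontal curve, because the contact equations say that each
coordinate is the derivative of the next lower one. Its speed is `√(1 + (F^(k+1))^2)`, so `y ↦ jet k
F y` is locally Lipschitz. The horizontal mapping is this curve composed with a translation and the
1-Lipschitz coordinate `x`, which gives both of its bounds.

The vertical mapping takes values in the plane `x = t`. In Euclidean coordinates it is smooth, and
the coordinates are Lipschitz from the Carnot-Carathéodory distance to the Euclidean one on sets
where `u` is bounded, so the Euclidean dimension of the image is at most `dimH E`. What remains is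
to return to the Carnot-Carathéodory distance inside the plane.

For this, `exists_edist_vertical_le` shows that points of the plane with `|u_j - v_j| ≤ h^(k+1-j)`
are at distance at most `C h`: leave the first point along a jet that merges with the Taylor
polynomial of the second after time `h`, then run back along that polynomial. The plane is thus
locally a `1/(k+1)`-Hölder image of Euclidean space, whence the factor `k+1`. Covering it by boxes
with sides `n^-(k+1-j)` bounds its dimension by `∑ (k+1-j) = (k+1)(k+2)/2`. -/

lemma edist_def (p q : JetSpace k) : edist p q = ccEDist p q := rfl

lemma isHorizontal_jet {F : ℝ → ℝ} (hF : ContDiff ℝ ∞ F) {a b : ℝ} (hab : a ≤ b) :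
    IsHorizontal (jet k F) a b where
  le := hab
  ac_x := (contDiff_id.contDiffOn (n := 1)).absolutelyContinuousOnInterval
  ac_u j := by
    have h : ContDiff ℝ 1 (iteratedDeriv j F) := by
      rw [iteratedDeriv_eq_iterate]
      exact (hF.iterate_deriv j).of_le (by exact_mod_cast le_top)
    exact h.contDiffOn.absolutelyContinuousOnInterval
  contact := by
    refine Eventually.of_forall fun s j => ?_
    simp [jet, iteratedDeriv_succ]

lemma edist_jet_le {F : ℝ → ℝ} (hF : ContDiff ℝ ∞ F) {a b C : ℝ} (hab : a ≤ b)
    (hC : ∀ s ∈ Icc a b, |iteratedDeriv (k + 1) F s| ≤ C) :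
    edist (jet k F a) (jet k F b) ≤ ENNReal.ofReal ((1 + C) * (b - a)) := by
  have hC0 : 0 ≤ C := (abs_nonneg _).trans (hC a ⟨le_rfl, hab⟩)
  rw [edist_def]
  have h0 : ccEDist (jet k F a) (jet k F b) ≤ length (jet k F) a b :=
    sInf_le ⟨jet k F, a, b, isHorizontal_jet hF hab, rfl, rfl, rfl⟩
  refine h0.trans ?_
  calc length (jet k F) a b ≤ ∫⁻ _ in Icc a b, ENNReal.ofReal (1 + C) := by
        refine setLIntegral_mono' measurableSet_Icc fun s hs => ENNReal.ofReal_le_ofReal ?_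
        have h1 : deriv (fun r => (jet k F r).x) s = 1 := by simp [jet]
        have h2 : deriv (fun r => (jet k F r).u (Fin.last k)) s = iteratedDeriv (k + 1) F s := by
          simp [jet, iteratedDeriv_succ]
        rw [speed, h1, h2]
        refine Real.sqrt_le_iff.2 ⟨by positivity, ?_⟩
        nlinarith [sq_abs (iteratedDeriv (k + 1) F s), hC s hs,
          abs_nonneg (iteratedDeriv (k + 1) F s)]
    _ = ENNReal.ofReal ((1 + C) * (b - a)) := by
        rw [setLIntegral_const, Real.volume_Icc, ENNReal.ofReal_mul (by positivity)]

/-- Only local, since the derivative of order `k+1` may be unbounded on the line. The neighbourhood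
is an interval, so the jet between two of its points stays where the bound holds. -/
lemma exists_lipschitzOnWith_jet (k : ℕ) {F : ℝ → ℝ} (hF : ContDiff ℝ ∞ F) (y : ℝ) :
    ∃ K : NNReal, ∃ s ∈ 𝓝 y, LipschitzOnWith K (jet k F) s := by
  have hc : Continuous (iteratedDeriv (k + 1) F) :=
    hF.continuous_iteratedDeriv _ (by exact_mod_cast le_top)
  obtain ⟨C, hC⟩ := isCompact_Icc.exists_bound_of_continuousOn
    (hc.continuousOn (s := Icc (y - 1) (y + 1)))
  have hC0 : 0 ≤ C := (norm_nonneg _).trans (hC y ⟨by linarith, by linarith⟩)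
  refine ⟨(1 + C).toNNReal, Icc (y - 1) (y + 1),
    Icc_mem_nhds (by linarith) (by linarith), ?_⟩
  have key : ∀ a ∈ Icc (y - 1) (y + 1), ∀ b ∈ Icc (y - 1) (y + 1), a ≤ b →
      edist (jet k F a) (jet k F b) ≤ ENNReal.ofReal ((1 + C) * (b - a)) := fun a ha b hb hab =>
    edist_jet_le hF hab fun s hs => hC s ⟨ha.1.trans hs.1, hs.2.trans hb.2⟩
  have e : ∀ d : ℝ, ((1 + C).toNNReal : ℝ≥0∞) * ENNReal.ofReal d = ENNReal.ofReal ((1 + C) * d) :=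
    fun d => by rw [ENNReal.ofReal_mul (by positivity)]; rfl
  intro a ha b hb
  rcases le_total a b with h | h
  · rw [edist_dist a, dist_comm, Real.dist_eq, abs_of_nonneg (sub_nonneg.2 h), e]
    exact key a ha b hb h
  · rw [edist_comm, edist_dist a, Real.dist_eq, abs_of_nonneg (sub_nonneg.2 h), e]
    exact key b hb a ha h

/-! ### Points of a vertical plane -/

/-- The monomial `s^j / j!`. -/
def taylorMonomial (j : ℕ) (s : ℝ) : ℝ := (j ! : ℝ)⁻¹ * s ^ j

/-- A smooth function that vanishes near `0` and is equal to `s^j / j!` near `1`. -/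
def cutoffMonomial (j : ℕ) (s : ℝ) : ℝ :=
  Real.smoothTransition (3 * s - 1) * taylorMonomial j s

lemma contDiff_taylorMonomial (j : ℕ) : ContDiff ℝ ∞ (taylorMonomial j) := by
  unfold taylorMonomial; fun_prop

lemma contDiff_cutoffMonomial (j : ℕ) : ContDiff ℝ ∞ (cutoffMonomial j) :=
  (Real.smoothTransition.contDiff.comp (by fun_prop)).mul (contDiff_taylorMonomial j)

lemma iteratedDeriv_taylorMonomial_zero (i j : ℕ) :
    iteratedDeriv i (taylorMonomial j) 0 = if i = j then 1 else 0 := by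
  have h : (j ! : ℝ) ≠ 0 := by exact_mod_cast j.factorial_ne_zero
  unfold taylorMonomial
  rw [iteratedDeriv_const_mul_field, iteratedDeriv_fun_pow_zero]
  split_ifs <;> simp [h]

lemma iteratedDeriv_taylorMonomial_of_lt {i j : ℕ} (h : j < i) (s : ℝ) :
    iteratedDeriv i (taylorMonomial j) s = 0 := by
  unfold taylorMonomial
  rw [iteratedDeriv_const_mul_field, iteratedDeriv_pow, Nat.descFactorial_eq_zero_iff_lt.2 h]
  simp

/-- With the next lemma: adding the cutoff monomial leaves the jet at `0` unchanged and has the full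
effect of the monomial at `1`. The cutoff is locally constant at both ends, so this holds for
derivatives of every order. -/
lemma iteratedDeriv_cutoffMonomial_zero (i j : ℕ) : iteratedDeriv i (cutoffMonomial j) 0 = 0 := by
  have h : cutoffMonomial j =ᶠ[𝓝 0] fun _ => 0 := by
    filter_upwards [Iio_mem_nhds (show (0 : ℝ) < 1 / 3 by norm_num)] with s hs
    rw [mem_Iio] at hs
    rw [cutoffMonomial, Real.smoothTransition.zero_of_nonpos (by linarith), zero_mul]
  rw [h.iteratedDeriv_eq i]
  simp

lemma iteratedDeriv_cutoffMonomial_one (i j : ℕ) :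
    iteratedDeriv i (cutoffMonomial j) 1 = iteratedDeriv i (taylorMonomial j) 1 := by
  refine Filter.EventuallyEq.iteratedDeriv_eq i ?_
  filter_upwards [Ioi_mem_nhds (show (2 / 3 : ℝ) < 1 by norm_num)] with s hs
  rw [mem_Ioi] at hs
  rw [cutoffMonomial, Real.smoothTransition.one_of_one_le (by linarith), one_mul]

lemma iteratedDeriv_comp_rescale {ψ : ℝ → ℝ} (hψ : ContDiff ℝ ∞ ψ) (h t : ℝ) (i : ℕ) (s : ℝ) :
    iteratedDeriv i (fun s => ψ (h⁻¹ * (s - t))) s =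
      h⁻¹ ^ i * iteratedDeriv i ψ (h⁻¹ * (s - t)) := by
  have h1 : iteratedDeriv i (fun s => ψ (h⁻¹ * (s - t))) s = _ :=
    congrFun (iteratedDeriv_comp_sub_const i (fun s => ψ (h⁻¹ * s)) t) s
  rw [h1, iteratedDeriv_comp_const_mul (hψ.of_le (by exact_mod_cast le_top))]

/-- A Taylor expansion at `t` with coefficients `v`, in which the monomials are replaced by smooth
functions `ψ j` of the variable rescaled by `h`. -/
def rescaledSum (h t : ℝ) (ψ : ℕ → ℝ → ℝ) (v : Fin (k + 1) → ℝ) (s : ℝ) : ℝ :=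
  ∑ j, v j * h ^ (j : ℕ) * ψ j (h⁻¹ * (s - t))

lemma contDiff_rescaledSum (h t : ℝ) {ψ : ℕ → ℝ → ℝ} (hψ : ∀ j, ContDiff ℝ ∞ (ψ j))
    (v : Fin (k + 1) → ℝ) : ContDiff ℝ ∞ (rescaledSum h t ψ v) := by
  unfold rescaledSum
  have := fun j => (hψ j).comp (f := fun s => h⁻¹ * (s - t)) (by fun_prop)
  exact ContDiff.sum fun j _ => contDiff_const.mul (this j)

lemma iteratedDeriv_rescaledSum (h t : ℝ) {ψ : ℕ → ℝ → ℝ} (hψ : ∀ j, ContDiff ℝ ∞ (ψ j))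
    (v : Fin (k + 1) → ℝ) (i : ℕ) (s : ℝ) :
    iteratedDeriv i (rescaledSum h t ψ v) s =
      ∑ j, v j * h ^ (j : ℕ) * (h⁻¹ ^ i * iteratedDeriv i (ψ j) (h⁻¹ * (s - t))) := by
  unfold rescaledSum
  rw [iteratedDeriv_fun_sum]
  · simp only [iteratedDeriv_const_mul_field, iteratedDeriv_comp_rescale (hψ _)]
  · intro j _
    have := (hψ j).comp (f := fun s => h⁻¹ * (s - t)) (by fun_prop)
    exact (contDiff_const.mul (this.of_le (by exact_mod_cast le_top))).contDiffAt

/-- For monomials the powers of `h` cancel, leaving the Taylor polynomial at `t` with coefficients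
`v`. -/
lemma jet_rescaledSum_taylorMonomial {h : ℝ} (hh : h ≠ 0) (t : ℝ) (v : Fin (k + 1) → ℝ) :
    jet k (rescaledSum h t taylorMonomial v) t = ⟨t, v⟩ := by
  ext i
  · rfl
  · change iteratedDeriv i _ t = v i
    rw [iteratedDeriv_rescaledSum h t contDiff_taylorMonomial]
    simp only [sub_self, mul_zero, iteratedDeriv_taylorMonomial_zero, ← Fin.ext_iff, mul_ite,
      mul_one, Finset.sum_ite_eq, Finset.mem_univ, if_true, mul_assoc, ← mul_pow]
    simp [hh]

/-- Two points of the plane `x = t` whose coordinates of index `j` are `h^(k+1-j)`-close are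
at Carnot-Carathéodory distance at most `C h`. -/
lemma exists_edist_vertical_le (k : ℕ) : ∃ C : ℝ, 0 ≤ C ∧ ∀ (t h : ℝ) (u v : Fin (k + 1) → ℝ),
    0 < h → (∀ j, |u j - v j| ≤ h ^ (k + 1 - (j : ℕ))) →
      edist (⟨t, u⟩ : JetSpace k) ⟨t, v⟩ ≤ ENNReal.ofReal (C * h) := by
  have hB : ∀ j : Fin (k + 1), ∃ B : ℝ, ∀ s ∈ Icc (0 : ℝ) 1,
      |iteratedDeriv (k + 1) (cutoffMonomial j) s| ≤ B := fun j =>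
    isCompact_Icc.exists_bound_of_continuousOn ((contDiff_cutoffMonomial j).continuous_iteratedDeriv
      (k + 1) (by exact_mod_cast le_top)).continuousOn
  choose B hB using hB
  have hB0 : ∀ j, 0 ≤ B j := fun j => (abs_nonneg _).trans (hB j 0 ⟨le_rfl, zero_le_one⟩)
  have hS : 0 ≤ ∑ j, B j := Finset.sum_nonneg fun j _ => hB0 j
  -- The first summand pays for the way out along `P u + G`, the second for the way back along `P
  -- v`, whose derivative of order `k+1` vanishes.
  refine ⟨(1 + ∑ j, B j) + 1, by positivity, fun t h u v hh huv => ?_⟩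
  set P := fun w : Fin (k + 1) → ℝ => rescaledSum h t taylorMonomial w with hP
  -- `P u + G` has the jet of `P u` at `t` and that of `P v` at `t + h`.
  set G := rescaledSum h t cutoffMonomial (fun j => v j - u j) with hG
  have cP : ∀ w, ContDiff ℝ ∞ (P w) := fun w => contDiff_rescaledSum h t contDiff_taylorMonomial w
  have cG : ContDiff ℝ ∞ G := contDiff_rescaledSum h t contDiff_cutoffMonomial _
  have top : ∀ w s, iteratedDeriv (k + 1) (P w) s = 0 := fun w s => by
    rw [hP, iteratedDeriv_rescaledSum h t contDiff_taylorMonomial]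
    refine Finset.sum_eq_zero fun j _ => ?_
    rw [iteratedDeriv_taylorMonomial_of_lt j.2]
    simp
  have add : ∀ i s, iteratedDeriv i (P u + G) s = iteratedDeriv i (P u) s + iteratedDeriv i G s :=
    fun i s => iteratedDeriv_add ((cP u).of_le (by exact_mod_cast le_top)).contDiffAt
      (cG.of_le (by exact_mod_cast le_top)).contDiffAt
  have hhi : h⁻¹ * (t + h - t) = 1 := by rw [add_sub_cancel_left, inv_mul_cancel₀ hh.ne']
  have e0 : jet k (P u + G) t = ⟨t, u⟩ := by
    rw [← jet_rescaledSum_taylorMonomial hh.ne' t u]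
    ext i
    · rfl
    · change iteratedDeriv i _ t = iteratedDeriv i _ t
      rw [add, hG, iteratedDeriv_rescaledSum h t contDiff_cutoffMonomial]
      simp [iteratedDeriv_cutoffMonomial_zero, hP]
  have e1 : jet k (P u + G) (t + h) = jet k (P v) (t + h) := by
    ext i
    · rfl
    · change iteratedDeriv i _ _ = iteratedDeriv i _ _
      rw [add, hG, hP, iteratedDeriv_rescaledSum h t contDiff_cutoffMonomial,
        iteratedDeriv_rescaledSum h t contDiff_taylorMonomial,
        iteratedDeriv_rescaledSum h t contDiff_taylorMonomial, ← Finset.sum_add_distrib]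
      refine Finset.sum_congr rfl fun j _ => ?_
      rw [hhi, iteratedDeriv_cutoffMonomial_one]
      ring
  have d1 : edist (jet k (P u + G) t) (jet k (P u + G) (t + h)) ≤
      ENNReal.ofReal ((1 + ∑ j, B j) * (t + h - t)) := by
    refine edist_jet_le (F := P u + G) ((cP u).add cG) (by linarith) fun s hs => ?_
    rw [add, top, zero_add, hG, iteratedDeriv_rescaledSum h t contDiff_cutoffMonomial]
    refine (Finset.abs_sum_le_sum_abs _ _).trans (Finset.sum_le_sum fun j _ => ?_)
    have hs' : h⁻¹ * (s - t) ∈ Icc (0 : ℝ) 1 := by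
      refine ⟨mul_nonneg (by positivity) (by linarith [hs.1]), ?_⟩
      rw [← inv_mul_cancel₀ hh.ne']
      exact mul_le_mul_of_nonneg_left (by linarith [hs.2]) (by positivity)
    rw [← mul_assoc, abs_mul]
    refine (mul_le_mul ?_ (hB j _ hs') (abs_nonneg _) zero_le_one).trans_eq (one_mul _)
    -- The weights balance: `h^(k+1-j)` from the hypothesis, `h^j` from the rescaled monomial and
    -- `h^-(k+1)` from the differentiation have product `1`.
    rw [abs_mul, abs_mul, abs_of_pos (show 0 < h ^ (j : ℕ) by positivity),
      abs_of_pos (show 0 < h⁻¹ ^ (k + 1) by positivity), abs_sub_comm]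
    calc |u j - v j| * h ^ (j : ℕ) * h⁻¹ ^ (k + 1)
        ≤ h ^ (k + 1 - (j : ℕ)) * h ^ (j : ℕ) * h⁻¹ ^ (k + 1) := by gcongr; exact huv j
      _ = 1 := by
        rw [← pow_add, Nat.sub_add_cancel j.2.le, ← mul_pow, mul_inv_cancel₀ hh.ne', one_pow]
  have d2 : edist (jet k (P v) t) (jet k (P v) (t + h)) ≤
      ENNReal.ofReal ((1 + 0) * (t + h - t)) :=
    edist_jet_le (cP v) (by linarith) fun s _ => by simp [top]
  rw [e0] at d1
  rw [hP, jet_rescaledSum_taylorMonomial hh.ne', edist_comm] at d2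
  rw [e1] at d1
  refine (edist_triangle _ _ _).trans ((add_le_add d1 d2).trans_eq ?_)
  rw [← ENNReal.ofReal_add (by rw [add_sub_cancel_left]; positivity)
    (by rw [add_sub_cancel_left]; positivity)]
  congr 1
  ring

/-! ### The coordinates are Lipschitz on bounded sets -/

/-- The identification of the jet space with `ℝ × ℝ^(k+1)`. -/
def coords (p : JetSpace k) : ℝ × (Fin (k + 1) → ℝ) := (p.x, p.u)

lemma exists_length_le {p q : JetSpace k} {L : ℝ} (h : edist p q < ENNReal.ofReal L) :
    ∃ (γ : ℝ → JetSpace k) (a b : ℝ),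
      IsHorizontal γ a b ∧ γ a = p ∧ γ b = q ∧ length γ a b ≤ ENNReal.ofReal L := by
  obtain ⟨_, ⟨γ, a, b, h2, h3, h4, rfl⟩, h6⟩ := sInf_lt_iff.1 h
  exact ⟨γ, a, b, h2, h3, h4, h6.le⟩

lemma lipschitzWith_x : LipschitzWith 1 (fun p : JetSpace k => p.x) := by
  intro p q
  rw [ENNReal.coe_one, one_mul]
  -- The infimum of lengths need not be attained, so the bound is proved against every number above
  -- the distance.
  refine le_of_forall_gt fun c hc => ?_
  obtain ⟨r, hr1, hr2⟩ := ENNReal.lt_iff_exists_nnreal_btwn.1 hc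
  rw [← ENNReal.ofReal_coe_nnreal] at hr1
  obtain ⟨γ, a, b, h, rfl, rfl, hl⟩ := exists_length_le hr1
  refine lt_of_le_of_lt ?_ hr2
  have := abs_sub_le_of_deriv_le h.le h.ac_x zero_le_one r.2 hl
    (Eventually.of_forall fun s => by simpa using abs_deriv_x_le_speed γ s) b ⟨h.le, le_rfl⟩
  rw [edist_comm, edist_dist, Real.dist_eq, ← ENNReal.ofReal_coe_nnreal]
  exact ENNReal.ofReal_le_ofReal (by simpa using this)

/-- On short horizontal curves that start in a bounded set the coordinates are controlled by the
length, uniformly in the starting point. -/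
lemma exists_uniform_coord_bound (M : ℝ) (j : Fin (k + 1)) :
    ∃ C : ℝ, 0 ≤ C ∧ ∀ (γ : ℝ → JetSpace k) (a b L : ℝ), IsHorizontal γ a b →
      (∀ i, |(γ a).u i| ≤ M) → 0 ≤ L → L ≤ 1 → length γ a b ≤ ENNReal.ofReal L →
      ∀ s ∈ Icc a b, |(γ s).u j - (γ a).u j| ≤ C * L := by
  induction j using Fin.reverseInduction with
  | last =>
    refine ⟨1, zero_le_one, fun γ a b L h _ hL0 _ hL => ?_⟩
    exact abs_sub_le_of_deriv_le h.le (h.ac_u _) zero_le_one hL0 hL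
      (Eventually.of_forall fun s => by simpa using abs_deriv_u_le_speed γ s)
  | cast j ih =>
    obtain ⟨C, hC, H⟩ := ih
    -- Since `u_j' = u_(j+1) x'`, the constant is a bound for `|u_(j+1)|` along the curve: at most
    -- `|M|` at the start, plus a change of at most `C L ≤ C`.
    refine ⟨|M| + C, by positivity, fun γ a b L h hM hL0 hL1 hL => ?_⟩
    refine abs_sub_le_of_deriv_le h.le (h.ac_u _) (by positivity) hL0 hL ?_
    filter_upwards [h.contact, ae_restrict_mem measurableSet_Icc] with s hs hsm
    rw [hs j, abs_mul]
    have b1 := H γ a b L h hM hL0 hL1 hL s hsm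
    have b2 : |(γ s).u j.succ| ≤ |M| + C := by
      have h1 := abs_sub_abs_le_abs_sub ((γ s).u j.succ) ((γ a).u j.succ)
      have h2 := (hM j.succ).trans (le_abs_self M)
      nlinarith
    exact mul_le_mul b2 (abs_deriv_x_le_speed γ s) (abs_nonneg _) (by positivity)

lemma exists_lipschitzOnWith_u (M : ℝ) (j : Fin (k + 1)) :
    ∃ K : NNReal, LipschitzOnWith K (fun p : JetSpace k => p.u j) {p | ∀ i, |p.u i| ≤ M} := by
  obtain ⟨C, hC, H⟩ := exists_uniform_coord_bound M j
  -- `C` serves curves of length at most `1`; beyond that the trivial bound `2 |M|` suffices. The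
  -- `1` makes `K` nonzero, so that an infinite distance gives an infinite right-hand side.
  obtain ⟨K, hK⟩ : ∃ K : NNReal, (K : ℝ) = C + 2 * |M| + 1 :=
    ⟨⟨C + 2 * |M| + 1, by positivity⟩, rfl⟩
  have hK0 : K ≠ 0 := fun h => by
    rw [h, NNReal.coe_zero] at hK
    linarith [abs_nonneg M]
  refine ⟨K, fun p hp q hq => ENNReal.le_of_forall_pos_le_add fun ε hε hfin => ?_⟩
  have htop : edist p q ≠ ⊤ := fun h => by
    rw [h, ENNReal.mul_top (by simpa using hK0)] at hfin
    exact lt_irrefl _ hfin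
  obtain ⟨η, hη, hηε⟩ : ∃ η : ℝ, 0 < η ∧ K * η ≤ ε := by
    refine ⟨ε / (K + 1), by positivity, ?_⟩
    rw [mul_div_assoc', div_le_iff₀ (by positivity)]
    nlinarith [NNReal.coe_nonneg K, show (0 : ℝ) < ε from hε]
  set L := (edist p q).toReal + η with hL
  have hL0 : 0 ≤ L := by positivity
  have hlt : edist p q < ENNReal.ofReal L := by
    rw [ENNReal.lt_ofReal_iff_toReal_lt htop]
    exact lt_add_of_pos_right _ hη
  have key : |q.u j - p.u j| ≤ K * L := by
    rw [hK]
    rcases le_or_gt L 1 with h1 | h1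
    · obtain ⟨γ, a, b, h, rfl, rfl, hl⟩ := exists_length_le hlt
      refine (H γ a b L h hp hL0 h1 hl b ⟨h.le, le_rfl⟩).trans ?_
      nlinarith [abs_nonneg M]
    · have h2 := abs_sub (q.u j) (p.u j)
      have h3 := hp j
      have h4 := hq j
      have h5 := le_abs_self M
      nlinarith [abs_nonneg M]
  rw [edist_comm, edist_dist, Real.dist_eq]
  calc ENNReal.ofReal |q.u j - p.u j| ≤ ENNReal.ofReal ((K : ℝ) * (edist p q).toReal + ε) := by
        refine ENNReal.ofReal_le_ofReal (key.trans ?_)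
        rw [hL, mul_add]
        linarith
    _ = K * edist p q + ε := by
        rw [ENNReal.ofReal_add (by positivity) (by positivity), ENNReal.ofReal_mul (by positivity),
          ENNReal.ofReal_coe_nnreal, ENNReal.ofReal_coe_nnreal, ENNReal.ofReal_toReal htop]

lemma exists_lipschitzOnWith_coords (k : ℕ) (M : ℝ) :
    ∃ K : NNReal, LipschitzOnWith K (coords (k := k)) {p | ∀ i, |p.u i| ≤ M} := by
  choose K hK using fun j => exists_lipschitzOnWith_u (k := k) M j
  refine ⟨max 1 (∑ j, K j), fun p hp q hq => ?_⟩
  rw [Prod.edist_eq]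
  refine max_le ((lipschitzWith_x p q).trans ?_) (edist_pi_le_iff.2 fun j => (hK j hp hq).trans ?_)
  · gcongr
    exact le_max_left _ _
  · gcongr
    exact (Finset.single_le_sum (fun i _ => zero_le) (Finset.mem_univ j)).trans
      (le_max_right _ _)

/-- Countable stability of the dimension reduces this to sets with bounded `u`. No bound on `x` is
needed, as the contact equations contain only its derivative. -/
lemma dimH_coords_image_le (E : Set (JetSpace k)) : dimH (coords '' E) ≤ dimH E := by
  have hE : E = ⋃ n : ℕ, E ∩ {p | ∀ i, |p.u i| ≤ (n : ℝ)} := by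
    rw [← inter_iUnion, eq_comm, inter_eq_left]
    intro p _
    obtain ⟨n, hn⟩ := exists_nat_ge ‖p.u‖
    exact mem_iUnion.2 ⟨n, fun i => (norm_le_pi_norm p.u i).trans hn⟩
  rw [hE, image_iUnion, dimH_iUnion, dimH_iUnion]
  refine iSup_mono fun n => ?_
  obtain ⟨K, hK⟩ := exists_lipschitzOnWith_coords k n
  exact (hK.mono inter_subset_right).dimH_image_le

/-! ### Hausdorff dimension in a vertical plane -/

lemma dimH_vertical_image_le (t : ℝ) (S : Set (Fin (k + 1) → ℝ)) :
    dimH ((fun u => (⟨t, u⟩ : JetSpace k)) '' S) ≤ ((k : ℝ≥0∞) + 1) * dimH S := by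
  obtain ⟨C, hC, H⟩ := exists_edist_vertical_le k
  have hr : (0 : NNReal) < (k + 1 : NNReal)⁻¹ := by positivity
  refine (dimH_image_le_of_locally_holder_on (r := (k + 1 : NNReal)⁻¹) hr
    -- Radius `1/2` keeps distances within the ball at most `1`.
    fun u _ => ⟨C.toNNReal, Metric.closedBall u 2⁻¹,
      mem_nhdsWithin_of_mem_nhds (Metric.closedBall_mem_nhds u (by norm_num)), ?_⟩).trans ?_
  · intro v hv w hw
    rcases eq_or_ne v w with rfl | hne
    · simp
    have hd : 0 < dist v w := dist_pos.2 hne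
    have hd1 : dist v w ≤ 1 := by
      have := dist_triangle_right v w u
      rw [Metric.mem_closedBall] at hv hw
      linarith
    -- The scale with `h^(k+1) = dist v w`. As `h ≤ 1`, this is at most `h^(k+1-j)` for every `j`;
    -- the worst coordinate is `u_0`.
    set h := dist v w ^ ((k + 1 : ℝ)⁻¹) with hh
    have hh0 : 0 < h := Real.rpow_pos_of_pos hd _
    have hh1 : h ≤ 1 := Real.rpow_le_one hd.le hd1 (by positivity)
    have hhk : h ^ (k + 1) = dist v w := by
      have := Real.rpow_inv_natCast_pow (n := k + 1) hd.le (by omega)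
      rw [hh]
      exact_mod_cast this
    refine (H t h v w hh0 fun j => ?_).trans_eq ?_
    · rw [← Real.dist_eq]
      refine (dist_le_pi_dist v w j).trans (hhk.symm.le.trans ?_)
      exact pow_le_pow_of_le_one hh0.le hh1 (Nat.sub_le _ _)
    · rw [ENNReal.ofReal_mul hC, hh, ← ENNReal.ofReal_rpow_of_pos hd, edist_dist]
      simp [ENNReal.ofReal]
  · rw [ENNReal.coe_inv (by positivity), ENNReal.div_eq_inv_mul, inv_inv]
    simp

/-- The cell with index `i` in the subdivision of the cube `∏ [z_j, z_j + 1]` into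
`∏ n^(k+1-j)` boxes with side lengths `n^-(k+1-j)`. -/
def cell (z : Fin (k + 1) → ℤ) (n : ℕ) (i : ∀ j : Fin (k + 1), Fin (n ^ (k + 1 - (j : ℕ)))) :
    Set (Fin (k + 1) → ℝ) :=
  {u | ∀ j, u j ∈ Icc (z j + (i j : ℕ) / (n : ℝ) ^ (k + 1 - (j : ℕ)))
    (z j + ((i j : ℕ) + 1) / (n : ℝ) ^ (k + 1 - (j : ℕ)))}

lemma Ico_subset_iUnion_cell (z : Fin (k + 1) → ℤ) {n : ℕ} (hn : 0 < n) :
    {u : Fin (k + 1) → ℝ | ∀ j, u j ∈ Ico (z j : ℝ) (z j + 1)} ⊆ ⋃ i, cell z n i := by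
  intro u hu
  have hN : ∀ j : Fin (k + 1), (0 : ℝ) < (n : ℝ) ^ (k + 1 - (j : ℕ)) := fun j => by positivity
  have h0 : ∀ j, 0 ≤ (u j - z j) * (n : ℝ) ^ (k + 1 - (j : ℕ)) := fun j =>
    mul_nonneg (by linarith [(hu j).1]) (hN j).le
  refine mem_iUnion.2 ⟨fun j => ⟨⌊(u j - z j) * (n : ℝ) ^ (k + 1 - (j : ℕ))⌋₊, ?_⟩, fun j => ?_⟩
  · rw [Nat.floor_lt (h0 j)]
    push_cast
    exact mul_lt_of_lt_one_left (hN j) (by linarith [(hu j).2])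
  · have h1 := Nat.floor_le (h0 j)
    have h2 := (Nat.lt_floor_add_one ((u j - z j) * (n : ℝ) ^ (k + 1 - (j : ℕ)))).le
    rw [← div_le_iff₀ (hN j)] at h1
    rw [← le_div_iff₀ (hN j)] at h2
    exact ⟨by linarith, by linarith⟩

lemma two_mul_sum_weights (k : ℕ) :
    2 * ∑ j : Fin (k + 1), (k + 1 - (j : ℕ)) = (k + 1) * (k + 2) := by
  rw [Fin.sum_univ_eq_sum_range (fun j => k + 1 - j) (k + 1),
    ← Finset.sum_range_reflect]
  have : ∀ m : ℕ, 2 * ∑ j ∈ Finset.range m, (j + 1) = m * (m + 1) := by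
    intro m
    induction m with
    | zero => simp
    | succ m ih => rw [Finset.sum_range_succ, mul_add, ih]; ring
  rw [← this (k + 1)]
  congr 1
  refine Finset.sum_congr rfl fun j hj => ?_
  have := Finset.mem_range.1 hj
  omega

/-- With `Q` the sum of the weights, the cube splits into `n^Q` cells of diameter at most `C / n`,
so the covering sums of order `Q` are at most `n^Q (C / n)^Q = C^Q`, independently of `n`. -/
lemma hausdorffMeasure_vertical_cube_ne_top (t : ℝ) (z : Fin (k + 1) → ℤ) :
    μH[((∑ j : Fin (k + 1), (k + 1 - (j : ℕ)) : ℕ) : ℝ)] ((fun u => (⟨t, u⟩ : JetSpace k)) ''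
      {u : Fin (k + 1) → ℝ | ∀ j, u j ∈ Ico (z j : ℝ) (z j + 1)}) ≠ ⊤ := by
  obtain ⟨C, hC, H⟩ := exists_edist_vertical_le k
  set Q := ∑ j : Fin (k + 1), (k + 1 - (j : ℕ)) with hQ
  have hr : Tendsto (fun n : ℕ => ENNReal.ofReal (C * (n : ℝ)⁻¹)) atTop (𝓝 0) := by
    have h := (tendsto_inv_atTop_nhds_zero_nat (𝕜 := ℝ)).const_mul C
    rw [mul_zero] at h
    simpa using ENNReal.tendsto_ofReal h
  have hdiam : ∀ n : ℕ, 0 < n → ∀ i, Metric.ediam ((fun u => (⟨t, u⟩ : JetSpace k)) ''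
      cell z n i) ≤ ENNReal.ofReal (C * (n : ℝ)⁻¹) := by
    intro n hn i
    refine Metric.ediam_le ?_
    rintro _ ⟨u, hu, rfl⟩ _ ⟨v, hv, rfl⟩
    -- The scale is `h = 1/n`: the cell has exactly the side lengths `h^(k+1-j)`.
    refine H t _ u v (by positivity) fun j => ?_
    have h1 := hu j
    have h2 := hv j
    rw [add_div, ← add_assoc, mem_Icc] at h1 h2
    rw [inv_pow, ← one_div, abs_le]
    constructor <;> linarith [h1.1, h1.2, h2.1, h2.2]
  refine ne_top_of_le_ne_top (b := ENNReal.ofReal (C ^ Q)) ENNReal.ofReal_ne_top ?_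
  refine (Measure.hausdorffMeasure_le_liminf_sum (l := atTop) _ _ _ hr
    (fun (n : ℕ) i => (fun u => (⟨t, u⟩ : JetSpace k)) '' cell z n i)
    ((eventually_gt_atTop 0).mono hdiam) ?_).trans ?_
  · filter_upwards [eventually_gt_atTop 0] with n hn
    rw [← image_iUnion]
    exact image_mono (Ico_subset_iUnion_cell z hn)
  · refine liminf_le_of_frequently_le' (Eventually.frequently ?_)
    filter_upwards [eventually_gt_atTop 0] with n hn
    calc _ ≤ ∑ _ : (∀ j : Fin (k + 1), Fin (n ^ (k + 1 - (j : ℕ)))),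
          ENNReal.ofReal (C * (n : ℝ)⁻¹) ^ (Q : ℝ) :=
          Finset.sum_le_sum fun i _ => ENNReal.rpow_le_rpow (hdiam n hn i) (Nat.cast_nonneg _)
      _ = ENNReal.ofReal (C ^ Q) := by
          rw [Finset.sum_const, Finset.card_univ, Fintype.card_pi]
          simp only [Fintype.card_fin]
          rw [Finset.prod_pow_eq_pow_sum, ← hQ, ENNReal.rpow_natCast,
            ← ENNReal.ofReal_pow (by positivity), nsmul_eq_mul, ← ENNReal.ofReal_natCast,
            ← ENNReal.ofReal_mul (by positivity)]
          congr 1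
          have : (n : ℝ) ≠ 0 := by positivity
          push_cast
          rw [mul_pow, inv_pow]
          field_simp

lemma dimH_range_vertical_le (t : ℝ) :
    dimH (range fun u => (⟨t, u⟩ : JetSpace k)) ≤ ((k : ℝ≥0∞) + 1) * ((k : ℝ≥0∞) + 2) / 2 := by
  have hU : range (fun u => (⟨t, u⟩ : JetSpace k)) = ⋃ z : Fin (k + 1) → ℤ,
      (fun u => (⟨t, u⟩ : JetSpace k)) '' {u | ∀ j, u j ∈ Ico (z j : ℝ) (z j + 1)} := by
    rw [← image_iUnion, ← image_univ]
    congr 1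
    exact (eq_univ_of_forall fun u => mem_iUnion.2
      ⟨fun j => ⌊u j⌋, fun j => ⟨Int.floor_le _, Int.lt_floor_add_one _⟩⟩).symm
  rw [hU, dimH_iUnion]
  refine iSup_le fun z => ?_
  refine (dimH_le_of_hausdorffMeasure_ne_top
    (d := ((∑ j : Fin (k + 1), (k + 1 - (j : ℕ)) : ℕ) : NNReal))
    (by rw [NNReal.coe_natCast]; exact hausdorffMeasure_vertical_cube_ne_top t z)).trans ?_
  rw [ENNReal.le_div_iff_mul_le (by simp) (by simp), mul_comm]
  exact_mod_cast (two_mul_sum_weights k).le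

/-! ### The vertical and the horizontal mapping -/

/-- The coordinates `u_j` of the vertical mapping, as functions of the coordinates of the point. -/
def verticalCoords (f : ℝ → ℝ) (t : ℝ) (p : ℝ × (Fin (k + 1) → ℝ)) : Fin (k + 1) → ℝ :=
  fun s => shift (t - p.1) (fun j => p.2 j - iteratedDeriv j f (p.1 - t)) s

/-- The base points cancel to `x - (x - t) = t`, and linearity of `shift` merges the two translated
Taylor polynomials into one. -/
lemma verticalMap_eq (f : ℝ → ℝ) (t : ℝ) (p : JetSpace k) :
    verticalMap f t p = ⟨t, verticalCoords f t (coords p)⟩ := by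
  ext s
  · simp [verticalMap, jet]
  · rw [verticalMap, mul_u, inv_u]
    have h : -(jet k f (p.x - t)).x = t - p.x := neg_sub p.x t
    simp only [inv_x, h, verticalCoords, coords, sub_eq_add_neg (p.u _), shift_add, shift_neg]
    rw [add_comm]
    rfl

lemma contDiff_verticalCoords {f : ℝ → ℝ} (hf : ContDiff ℝ ∞ f) (t : ℝ) :
    ContDiff ℝ 1 (verticalCoords (k := k) f t) := by
  have hd : ∀ j : ℕ, ContDiff ℝ 1 (iteratedDeriv j f) := fun j => by
    rw [iteratedDeriv_eq_iterate]
    exact (hf.iterate_deriv j).of_le (by exact_mod_cast le_top)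
  refine contDiff_pi.2 fun s => ?_
  unfold verticalCoords shift
  refine ContDiff.sum fun j _ => ContDiff.mul (ContDiff.sub (by fun_prop) ?_) (by fun_prop)
  exact (hd j).comp (by fun_prop)

/-- Passing to Euclidean coordinates and applying a `C^1` map do not raise the dimension; the factor
`k+1` arises only on the return to the Carnot-Carathéodory distance in the plane. -/
lemma dimH_verticalMap_image_le {f : ℝ → ℝ} (hf : ContDiff ℝ ∞ f) (t : ℝ) (E : Set (JetSpace k)) :
    dimH (verticalMap f t '' E) ≤
      min (((k : ℝ≥0∞) + 1) * dimH E) (((k : ℝ≥0∞) + 1) * ((k : ℝ≥0∞) + 2) / 2) := by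
  have h : verticalMap f t '' E =
      (fun u => (⟨t, u⟩ : JetSpace k)) '' (verticalCoords f t '' (coords '' E)) := by
    rw [image_image, image_image]
    exact image_congr fun p _ => verticalMap_eq f t p
  rw [h]
  refine le_min ((dimH_vertical_image_le t _).trans ?_)
    ((dimH_mono (image_subset_range _ _)).trans (dimH_range_vertical_le t))
  gcongr
  exact ((contDiff_verticalCoords hf t).contDiffOn.dimH_image_le convex_univ
    (subset_univ _)).trans (dimH_coords_image_le E)

lemma dimH_horizontalMap_image_le {f : ℝ → ℝ} (hf : ContDiff ℝ ∞ f) (t : ℝ)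
    (E : Set (JetSpace k)) : dimH (horizontalMap f t '' E) ≤ min (dimH E) 1 := by
  have h : horizontalMap f t '' E =
      jet k f '' ((fun x => x - t) '' ((fun p : JetSpace k => p.x) '' E)) := by
    rw [image_image, image_image]
    rfl
  have h1 : ∀ S : Set ℝ, dimH (jet k f '' S) ≤ dimH S := fun S =>
    dimH_image_le_of_locally_lipschitzOn fun y _ => by
      obtain ⟨K, s, hs, hK⟩ := exists_lipschitzOnWith_jet k hf y
      exact ⟨K, s, mem_nhdsWithin_of_mem_nhds hs, hK⟩
  rw [h]
  refine (h1 _).trans (le_min ?_ ((dimH_mono (subset_univ _)).trans_eq Real.dimH_univ))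
  have h2 : Isometry fun x : ℝ => x - t := Isometry.of_dist_eq fun x y => dist_sub_right x y t
  rw [h2.dimH_image]
  simpa using lipschitzWith_x.dimH_image_le E

end JetSpace

end


theorem mainTheorem9 (k : ℕ) (hk : 1 ≤ k) (f : ℝ → ℝ) (hf : ContDiff ℝ ∞ f) (t : ℝ)
    (E : Set (JetSpace k)) (hE : MeasurableSet E) :
    dimH (JetSpace.verticalMap f t '' E) ≤
        min (((k : ℝ≥0∞) + 1) * dimH E) (((k : ℝ≥0∞) + 1) * ((k : ℝ≥0∞) + 2) / 2) ∧
      dimH (JetSpace.horizontalMap f t '' E) ≤ min (dimH E) 1 :=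
  ⟨JetSpace.dimH_verticalMap_image_le hf t E, JetSpace.dimH_horizontalMap_image_le hf t E⟩
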